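/- A chain is a linearly ordered set $X$; $\mathrm{Aut}(X)$ is its group of order-preserving bijections. The chain $X$ is homogeneous if $\mathrm{Aut}(X)$ acts transitively on it. A non-empty interval (order-convex subset) $J\subseteq X$ is a regular interval of $X$ if for all $x,y\in J$ and $g\in\mathrm{Aut}(X)$, $g(x)\in J$ implies $g(y)\in J$; it is proper if it is neither a single point nor all of $X$. A homogeneous chain is simple if it has no proper regular intervals. For a regular interval $J$ of a homogeneous chain $X$, $X/J$ denotes the chain of equivalence classes of the relation $$x\sim_J y\iff \forall g\in\mathrm{Aut}(X)\ \bigl(g(x)\in J\Rightarrow g(y)\in J\bigr)$$ (the classes are order-convex) with the order induced from $X$. On the automorphism group of a chain, $\tau_p$ is the topology of pointwise convergence, the chain carrying its order topology, and $\tau_\partial$ is the permutation topology, in which the stabilizers of points form a subbase of neighbourhoods of the unit. A topological group is Roelcke precompact if its Roelcke uniformity $L\wedge R$ (the greatest lower bound of the left and the right uniformity, i.e. the finest uniformity coarser than both) is totally bounded. Theorem. Let $X$ be a homogeneous chain that is not simple and such that no proper regular interval $J$ of $X$, regarded as a chain, is simple. Then $(\mathrm{Aut}(X),\tau_p)$ is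 Roelcke precompact if and only if, for every proper regular interval $J$ of $X$, the group $(\mathrm{Aut}(X/J),\tau_\partial)$ is Roelcke precompact. -/

import Mathlib

open Set Filter Topology

/-! ### Homogeneous chains and regular intervals -/

/-- A chain (linearly ordered set) is homogeneous if its automorphism group acts transitively. -/
def IsHomogeneousChain (X : Type*) [LinearOrder X] : Prop :=
  ∀ x y : X, ∃ g : X ≃o X, g x = y

/-- A regular interval: a nonempty interval `J` such that every automorphism that sends some
point of `J` into `J` sends all points of `J` into `J`. -/
structure IsRegularInterval {X : Type*} [LinearOrder X] (J : Set X) : Prop where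
  nonempty : J.Nonempty
  ordConnected : J.OrdConnected
  regular : ∀ x ∈ J, ∀ y ∈ J, ∀ g : X ≃o X, g x ∈ J → g y ∈ J

/-- A proper regular interval is one that is neither a single point nor the whole chain. -/
structure IsProperRegularInterval {X : Type*} [LinearOrder X] (J : Set X) : Prop extends
    IsRegularInterval J where
  nontrivial : J.Nontrivial
  ne_univ : J ≠ univ

/-- A chain is simple if it is homogeneous and has no proper regular intervals. -/
def IsSimpleChain (X : Type*) [LinearOrder X] : Prop :=
  IsHomogeneousChain X ∧ ∀ J : Set X, ¬ IsProperRegularInterval J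

/-! ### The quotient chain `X/J` -/

/-- `x ∼_J y` iff every automorphism that sends `x` into `J` also sends `y` into `J`. -/
def intervalRel {X : Type*} [LinearOrder X] (J : Set X) (x y : X) : Prop :=
  ∀ g : X ≃o X, g x ∈ J → g y ∈ J

theorem intervalRel_symm {X : Type*} [LinearOrder X] (hX : IsHomogeneousChain X) {J : Set X}
    (hJ : IsRegularInterval J) {x y : X} (h : intervalRel J x y) : intervalRel J y x := by
  intro g hg
  obtain ⟨a, ha⟩ := hJ.nonempty
  obtain ⟨k, hk⟩ := hX x a
  have hkx : k x ∈ J := hk ▸ ha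
  have hky : k y ∈ J := h k hkx
  have := hJ.regular (k y) hky (k x) hkx (k.symm.trans g) (by simpa using hg)
  simpa using this

/-- The equivalence relation `∼_J` of a regular interval `J` of a homogeneous chain. -/
def intervalSetoid {X : Type*} [LinearOrder X] (hX : IsHomogeneousChain X) {J : Set X}
    (hJ : IsRegularInterval J) : Setoid X where
  r := intervalRel J
  iseqv :=
    { refl := fun _ _ hg => hg
      symm := fun h => intervalRel_symm hX hJ h
      trans := fun h₁ h₂ g hg => h₂ g (h₁ g hg) }

/-- The set `X/J` of equivalence classes of `∼_J`. -/
def IntervalQuotient {X : Type*} [LinearOrder X] (hX : IsHomogeneousChain X) {J : Set X}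
    (hJ : IsRegularInterval J) : Type _ :=
  Quotient (intervalSetoid hX hJ)

namespace IntervalQuotient

/-- The class `J_x` of a point `x`. -/
def mk {X : Type*} [LinearOrder X] (hX : IsHomogeneousChain X) {J : Set X}
    (hJ : IsRegularInterval J) (x : X) : IntervalQuotient hX hJ :=
  Quotient.mk (intervalSetoid hX hJ) x

theorem mk_eq_mk {X : Type*} [LinearOrder X] (hX : IsHomogeneousChain X) {J : Set X}
    (hJ : IsRegularInterval J) {x y : X} : mk hX hJ x = mk hX hJ y ↔ intervalRel J x y :=
  Quotient.eq (r := intervalSetoid hX hJ)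

theorem exists_mk {X : Type*} [LinearOrder X] (hX : IsHomogeneousChain X) {J : Set X}
    (hJ : IsRegularInterval J) (P : IntervalQuotient hX hJ) : ∃ x, mk hX hJ x = P :=
  Quotient.exists_rep P

/-- `P ≤ Q` iff some point of the class `P` is `≤` some point of the class `Q`. -/
instance {X : Type*} [LinearOrder X] (hX : IsHomogeneousChain X) {J : Set X}
    (hJ : IsRegularInterval J) : LE (IntervalQuotient hX hJ) where
  le P Q := ∃ x y : X, mk hX hJ x = P ∧ mk hX hJ y = Q ∧ x ≤ y

theorem mk_eq_of_between {X : Type*} [LinearOrder X] (hX : IsHomogeneousChain X) {J : Set X}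
    (hJ : IsRegularInterval J) {x y z : X} (h : mk hX hJ x = mk hX hJ y) (hxz : x ≤ z)
    (hzy : z ≤ y) : mk hX hJ x = mk hX hJ z := by
  rw [mk_eq_mk] at h ⊢
  intro g hg
  exact hJ.ordConnected.out hg (h g hg) ⟨g.monotone hxz, g.monotone hzy⟩

theorem mk_le_mk {X : Type*} [LinearOrder X] (hX : IsHomogeneousChain X) {J : Set X}
    (hJ : IsRegularInterval J) {x y : X} :
    mk hX hJ x ≤ mk hX hJ y ↔ x ≤ y ∨ mk hX hJ x = mk hX hJ y := by
  constructor
  · rintro ⟨x', y', hx, hy, hle⟩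
    by_contra! hcon
    obtain ⟨hlt, hne⟩ := hcon
    rcases le_or_gt x' y with h | h
    · exact hne (hx.symm.trans (mk_eq_of_between hX hJ hx h hlt.le))
    · exact hne (hx.symm.trans (mk_eq_of_between hX hJ hy.symm h.le hle).symm)
  · rintro (h | h)
    · exact ⟨x, y, rfl, rfl, h⟩
    · exact ⟨x, x, rfl, h, le_rfl⟩

/-- The quotient chain `X/J`. -/
noncomputable instance {X : Type*} [LinearOrder X] (hX : IsHomogeneousChain X) {J : Set X}
    (hJ : IsRegularInterval J) : LinearOrder (IntervalQuotient hX hJ) where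
  le_refl P := by
    obtain ⟨x, rfl⟩ := exists_mk hX hJ P
    exact (mk_le_mk hX hJ).2 (Or.inl le_rfl)
  le_trans P Q R hPQ hQR := by
    obtain ⟨x, rfl⟩ := exists_mk hX hJ P
    obtain ⟨y, rfl⟩ := exists_mk hX hJ Q
    obtain ⟨z, rfl⟩ := exists_mk hX hJ R
    rcases (mk_le_mk hX hJ).1 hPQ with h₁ | h₁
    · rcases (mk_le_mk hX hJ).1 hQR with h₂ | h₂
      · exact (mk_le_mk hX hJ).2 (Or.inl (h₁.trans h₂))
      · rwa [← h₂]
    · rwa [h₁]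
  le_antisymm P Q hPQ hQP := by
    obtain ⟨x, rfl⟩ := exists_mk hX hJ P
    obtain ⟨y, rfl⟩ := exists_mk hX hJ Q
    rcases (mk_le_mk hX hJ).1 hPQ with h₁ | h₁
    · rcases (mk_le_mk hX hJ).1 hQP with h₂ | h₂
      · rw [le_antisymm h₁ h₂]
      · exact h₂.symm
    · exact h₁
  le_total P Q := by
    obtain ⟨x, rfl⟩ := exists_mk hX hJ P
    obtain ⟨y, rfl⟩ := exists_mk hX hJ Q
    rcases le_total x y with h | h
    · exact Or.inl ((mk_le_mk hX hJ).2 (Or.inl h))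
    · exact Or.inr ((mk_le_mk hX hJ).2 (Or.inl h))
  toDecidableLE := Classical.decRel _

end IntervalQuotient

/-! ### The topological groups `(Aut X, τ_p)` and `(Aut X, τ_∂)` -/

/-- The group `Aut X`, to be given the topology `τ_p` of pointwise convergence with respect to
the order topology of `X`. -/
def AutPointwise (X : Type*) [LinearOrder X] : Type _ := X ≃o X

namespace AutPointwise

instance (X : Type*) [LinearOrder X] : Group (AutPointwise X) :=
  inferInstanceAs (Group (X ≃o X))

/-- The evaluation `g ↦ (x ↦ g x)`. -/
def eval {X : Type*} [LinearOrder X] (g : AutPointwise X) : X → X :=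
  fun x => (show X ≃o X from g) x

/-- `τ_p`: the topology induced by the product topology of `X → X`, where `X` carries the order
topology. -/
instance (X : Type*) [LinearOrder X] : TopologicalSpace (AutPointwise X) :=
  TopologicalSpace.induced eval (@Pi.topologicalSpace X (fun _ => X) fun _ => Preorder.topology X)

theorem strictMono_eval {X : Type*} [LinearOrder X] (g : AutPointwise X) : StrictMono g.eval :=
  (show X ≃o X from g).strictMono

theorem eval_mul {X : Type*} [LinearOrder X] (f g : AutPointwise X) (x : X) :
    (f * g).eval x = f.eval (g.eval x) := rfl

theorem eval_inv_eval {X : Type*} [LinearOrder X] (f : AutPointwise X) (x : X) :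
    f⁻¹.eval (f.eval x) = x := by
  rw [← eval_mul, inv_mul_cancel]; rfl

theorem eval_eval_inv {X : Type*} [LinearOrder X] (f : AutPointwise X) (x : X) :
    f.eval (f⁻¹.eval x) = x := by
  rw [← eval_mul, mul_inv_cancel]; rfl

theorem tendsto_iff {X : Type*} [LinearOrder X] {α : Type*} {l : Filter α}
    {u : α → AutPointwise X} {g : AutPointwise X} :
    Tendsto u l (𝓝 g) ↔ ∀ x, (∀ a < g.eval x, ∀ᶠ i in l, a < (u i).eval x) ∧
      ∀ a > g.eval x, ∀ᶠ i in l, (u i).eval x < a := by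
  let _ : TopologicalSpace X := Preorder.topology X
  have : OrderTopology X := ⟨rfl⟩
  have hi : IsInducing (eval : AutPointwise X → X → X) := ⟨rfl⟩
  rw [hi.tendsto_nhds_iff, tendsto_pi_nhds]
  exact forall_congr' fun x => tendsto_order

instance (X : Type*) [LinearOrder X] : IsTopologicalGroup (AutPointwise X) where
  continuous_mul := by
    rw [continuous_iff_continuousAt]
    rintro ⟨f, g⟩
    have hf := tendsto_iff.1 (continuous_fst.tendsto (f, g))
    have hg := tendsto_iff.1 (continuous_snd.tendsto (f, g))
    refine tendsto_iff.2 fun x => ⟨fun a ha => ?_, fun a ha => ?_⟩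
    · change a < f.eval (g.eval x) at ha
      have hb : f⁻¹.eval a < g.eval x := by
        have := strictMono_eval f⁻¹ ha
        rwa [eval_inv_eval] at this
      by_cases hc : ∃ c, f⁻¹.eval a < c ∧ c < g.eval x
      · obtain ⟨c, hbc, hcx⟩ := hc
        have hac : a < f.eval c := by
          have := strictMono_eval f hbc
          rwa [eval_eval_inv] at this
        filter_upwards [(hf c).1 a hac, (hg x).1 c hcx] with p hp₁ hp₂
        exact hp₁.trans (strictMono_eval p.1 hp₂)
      · push Not at hc
        filter_upwards [(hf (g.eval x)).1 a ha, (hg x).1 _ hb] with p hp₁ hp₂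
        exact hp₁.trans_le ((strictMono_eval p.1).monotone (hc _ hp₂))
    · change f.eval (g.eval x) < a at ha
      have hb : g.eval x < f⁻¹.eval a := by
        have := strictMono_eval f⁻¹ ha
        rwa [eval_inv_eval] at this
      by_cases hc : ∃ c, g.eval x < c ∧ c < f⁻¹.eval a
      · obtain ⟨c, hxc, hcb⟩ := hc
        have hac : f.eval c < a := by
          have := strictMono_eval f hcb
          rwa [eval_eval_inv] at this
        filter_upwards [(hf c).2 a hac, (hg x).2 c hxc] with p hp₁ hp₂
        exact (strictMono_eval p.1 hp₂).trans hp₁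
      · push Not at hc
        filter_upwards [(hf (g.eval x)).2 a ha, (hg x).2 _ hb] with p hp₁ hp₂
        refine lt_of_le_of_lt ((strictMono_eval p.1).monotone ?_) hp₁
        by_contra! h
        exact absurd hp₂ (not_lt.2 (hc _ h))
  continuous_inv := by
    rw [continuous_iff_continuousAt]
    intro f
    have hf := tendsto_iff.1 (tendsto_id (x := 𝓝 f))
    refine tendsto_iff.2 fun x => ⟨fun a ha => ?_, fun a ha => ?_⟩
    · have hb : f.eval a < x := by
        have := strictMono_eval f ha
        rwa [eval_eval_inv] at this
      filter_upwards [(hf a).2 x hb] with p hp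
      have := strictMono_eval p⁻¹ hp
      rwa [id, eval_inv_eval] at this
    · have hb : x < f.eval a := by
        have := strictMono_eval f ha
        rwa [eval_eval_inv] at this
      filter_upwards [(hf a).1 x hb] with p hp
      have := strictMono_eval p⁻¹ hp
      rwa [id, eval_inv_eval] at this

end AutPointwise

/-- The group `Aut X`, to be given the permutation topology `τ_∂`. -/
def AutPermutation (X : Type*) [LinearOrder X] : Type _ := X ≃o X

namespace AutPermutation

instance (X : Type*) [LinearOrder X] : Group (AutPermutation X) :=
  inferInstanceAs (Group (X ≃o X))

/-- The evaluation `g ↦ (x ↦ g x)`. -/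
def eval {X : Type*} [LinearOrder X] (g : AutPermutation X) : X → X :=
  fun x => (show X ≃o X from g) x

/-- `τ_∂`: the topology induced by the product topology of `X → X`, where `X` is discrete. The
stabilizers of points form a subbase of neighbourhoods of the unit. -/
instance (X : Type*) [LinearOrder X] : TopologicalSpace (AutPermutation X) :=
  TopologicalSpace.induced eval (@Pi.topologicalSpace X (fun _ => X) fun _ => ⊥)

theorem eval_mul {X : Type*} [LinearOrder X] (f g : AutPermutation X) (x : X) :
    (f * g).eval x = f.eval (g.eval x) := rfl

theorem eval_inv_eval {X : Type*} [LinearOrder X] (f : AutPermutation X) (x : X) :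
    f⁻¹.eval (f.eval x) = x := by
  rw [← eval_mul, inv_mul_cancel]; rfl

theorem eval_eval_inv {X : Type*} [LinearOrder X] (f : AutPermutation X) (x : X) :
    f.eval (f⁻¹.eval x) = x := by
  rw [← eval_mul, mul_inv_cancel]; rfl

theorem tendsto_iff {X : Type*} [LinearOrder X] {α : Type*} {l : Filter α}
    {u : α → AutPermutation X} {g : AutPermutation X} :
    Tendsto u l (𝓝 g) ↔ ∀ x, ∀ᶠ i in l, (u i).eval x = g.eval x := by
  let _ : TopologicalSpace X := ⊥
  have : DiscreteTopology X := ⟨rfl⟩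
  have hi : IsInducing (eval : AutPermutation X → X → X) := ⟨rfl⟩
  rw [hi.tendsto_nhds_iff, tendsto_pi_nhds]
  refine forall_congr' fun x => ?_
  rw [nhds_discrete, tendsto_pure]
  rfl

instance (X : Type*) [LinearOrder X] : IsTopologicalGroup (AutPermutation X) where
  continuous_mul := by
    rw [continuous_iff_continuousAt]
    rintro ⟨f, g⟩
    have hf := tendsto_iff.1 (continuous_fst.tendsto (f, g))
    have hg := tendsto_iff.1 (continuous_snd.tendsto (f, g))
    refine tendsto_iff.2 fun x => ?_
    filter_upwards [hf (g.eval x), hg x] with p hp₁ hp₂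
    rw [eval_mul, eval_mul, hp₂, hp₁]
  continuous_inv := by
    rw [continuous_iff_continuousAt]
    intro f
    have hf := tendsto_iff.1 (tendsto_id (x := 𝓝 f))
    refine tendsto_iff.2 fun x => ?_
    filter_upwards [hf (f⁻¹.eval x)] with p hp
    rw [eval_eval_inv] at hp
    change p.eval (f⁻¹.eval x) = x at hp
    have h := eval_inv_eval p (f⁻¹.eval x)
    rwa [hp] at h

end AutPermutation

/-! ### Roelcke precompactness -/

/-- The Roelcke uniformity `L ∧ R` of a topological group: the finest uniformity that is coarser
than both the left and the right uniformity. (Mathlib orders uniformities the other way round,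
finer ones being smaller, so that this is the join.) -/
@[reducible]
def roelckeUniformSpace (G : Type*) [Group G] [TopologicalSpace G] [IsTopologicalGroup G] :
    UniformSpace G :=
  IsTopologicalGroup.leftUniformSpace G ⊔ IsTopologicalGroup.rightUniformSpace G

/-- A topological group is Roelcke precompact if its Roelcke uniformity is totally bounded. -/
def IsRoelckePrecompact (G : Type*) [Group G] [TopologicalSpace G] [IsTopologicalGroup G] :
    Prop :=
  @TotallyBounded G (roelckeUniformSpace G) univ

/-! Roelcke precompactness means `G = U F U` with `F` finite, for every neighbourhood `U` of the
unit (`isRoelckePrecompact_iff`). This condition passes to continuous surjective images, and it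
lifts along a surjection for those `U` that contain the preimage of a neighbourhood of the unit.

Both transfers apply to `Aut X → Aut (X/J)`. It is onto because automorphisms carrying classes to
classes can be glued. It is continuous from `τ_p` to `τ_∂` because each class surrounds each of its
points. This gives one direction.

For the other, every `τ_p`-neighbourhood of the unit must come from a single quotient
(`exists_mem_comap_autHom`). The relations `∼_J` form a chain under inclusion
(`intervalRel_le_total`). Their intersection is equality (`exists_not_intervalRel_of_ne`): a
nontrivial class of it would be a smallest proper regular interval around its points, hence simple,
which is excluded. -/

/-! ### Roelcke precompactness through double cosets -/

/-- The uniformity with entourages `{(x, y) | y ∈ U x U}`. -/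
def doubleCosetCore (G : Type*) [Group G] [TopologicalSpace G] [IsTopologicalGroup G] :
    UniformSpace.Core G where
  uniformity := (𝓝 (1 : G)).lift' fun U => {p : G × G | ∃ u ∈ U, ∃ v ∈ U, p.2 = u * p.1 * v}
  refl := by
    refine Filter.le_lift'.2 fun U hU => ?_
    rintro ⟨x, y⟩ (rfl : x = y)
    exact ⟨1, mem_of_mem_nhds hU, 1, mem_of_mem_nhds hU, by simp⟩
  symm := by
    refine Filter.tendsto_lift'.2 fun U hU => ?_
    have hU' : U⁻¹ ∈ 𝓝 (1 : G) := inv_mem_nhds_one G hU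
    refine Filter.mem_of_superset (Filter.mem_lift' hU') ?_
    rintro ⟨x, y⟩ ⟨u, hu, v, hv, h⟩
    refine ⟨u⁻¹, hu, v⁻¹, hv, ?_⟩
    change y = u * x * v at h
    change x = u⁻¹ * y * v⁻¹
    rw [h]; group
  comp := by
    intro s hs
    obtain ⟨U, hU, hUs⟩ := (Filter.mem_lift'_sets (by
      rintro U V h p ⟨u, hu, v, hv, e⟩
      exact ⟨u, h hu, v, h hv, e⟩)).1 hs
    obtain ⟨V, hV, hVU⟩ := exists_nhds_one_split hU
    refine Filter.mem_of_superset (Filter.mem_lift' (Filter.mem_lift' hV)) ?_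
    rintro ⟨x, y⟩ ⟨z, ⟨u, hu, v, hv, h⟩, ⟨u', hu', v', hv', h'⟩⟩
    refine hUs ⟨u' * u, hVU _ hu' _ hu, v * v', hVU _ hv _ hv', ?_⟩
    change z = u * x * v at h
    change y = u' * z * v' at h'
    change y = _ * x * _
    rw [h', h]; group

/-- One-sided translations are double translations with one factor `1`. Only this inclusion is
needed. -/
theorem roelckeUniformSpace_le_doubleCoset (G : Type*) [Group G] [TopologicalSpace G]
    [IsTopologicalGroup G] :
    roelckeUniformSpace G ≤ UniformSpace.ofCore (doubleCosetCore G) := by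
  refine sup_le ?_ ?_
  · refine Filter.le_lift'.2 fun U hU => ?_
    refine ⟨U, hU, ?_⟩
    rintro ⟨x, y⟩ h
    exact ⟨1, mem_of_mem_nhds hU, _, h, by simp⟩
  · refine Filter.le_lift'.2 fun U hU => ?_
    refine ⟨U, hU, ?_⟩
    rintro ⟨x, y⟩ h
    refine ⟨y * x⁻¹, ?_, 1, mem_of_mem_nhds hU, by simp⟩
    simpa [div_eq_mul_inv] using h

/-- A topological group `G` is Roelcke precompact iff for each neighbourhood `U` of the unit there
is a finite set `F` with `U F U = G`. -/
theorem isRoelckePrecompact_iff {G : Type*} [Group G] [TopologicalSpace G]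
    [IsTopologicalGroup G] :
    IsRoelckePrecompact G ↔
      ∀ U ∈ 𝓝 (1 : G), ∃ F : Set G, F.Finite ∧ ∀ g, ∃ u ∈ U, ∃ f ∈ F, ∃ v ∈ U,
        g = u * f * v := by
  constructor
  · intro h U hU
    have hU' : U⁻¹ ∈ 𝓝 (1 : G) := inv_mem_nhds_one G hU
    obtain ⟨F, hF, hc⟩ := h _ (roelckeUniformSpace_le_doubleCoset G (Filter.mem_lift' hU'))
    refine ⟨F, hF, fun g => ?_⟩
    obtain ⟨f, hf, u, hu, v, hv, e⟩ := mem_iUnion₂.1 (hc (mem_univ g))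
    change f = u * g * v at e
    exact ⟨u⁻¹, hu, f, hf, v⁻¹, hv, by rw [e]; group⟩
  · intro h d hd
    obtain ⟨d', hd', hdd⟩ := @comp_mem_uniformity_sets G (roelckeUniformSpace G) d hd
    have hL : IsTopologicalGroup.leftUniformSpace G ≤ roelckeUniformSpace G := le_sup_left
    have hR : IsTopologicalGroup.rightUniformSpace G ≤ roelckeUniformSpace G := le_sup_right
    obtain ⟨U, hU, hUd⟩ := hL hd'
    obtain ⟨V, hV, hVd⟩ := hR hd'
    obtain ⟨F, hF, hc⟩ := h _ (inv_mem_nhds_one G (Filter.inter_mem hU hV))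
    refine ⟨F, hF, fun g _ => ?_⟩
    obtain ⟨u, hu, f, hf, v, hv, rfl⟩ := hc g
    -- The point `u * f` is left-close to `u * f * v` and right-close to `f`.
    refine mem_iUnion₂.2 ⟨f, hf, hdd ⟨u * f, hUd ?_, hVd ?_⟩⟩
    · have : (u * f * v)⁻¹ * (u * f) = v⁻¹ := by group
      change (u * f * v)⁻¹ * (u * f) ∈ U
      rw [this]; exact hv.1
    · have : f * (u * f)⁻¹ = u⁻¹ := by group
      simpa [div_eq_mul_inv] using hu.2

theorem IsRoelckePrecompact.of_surjective {G H : Type*} [Group G] [TopologicalSpace G]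
    [IsTopologicalGroup G] [Group H] [TopologicalSpace H] [IsTopologicalGroup H]
    (hG : IsRoelckePrecompact G) (φ : G →* H) (hφ : Function.Surjective φ)
    (hc : Tendsto φ (𝓝 1) (𝓝 1)) : IsRoelckePrecompact H := by
  rw [isRoelckePrecompact_iff] at hG ⊢
  intro U hU
  obtain ⟨F, hF, h⟩ := hG _ (hc hU)
  refine ⟨φ '' F, hF.image φ, fun g => ?_⟩
  obtain ⟨g, rfl⟩ := hφ g
  obtain ⟨u, hu, f, hf, v, hv, rfl⟩ := h g
  exact ⟨φ u, hu, φ f, mem_image_of_mem φ hf, φ v, hv, by simp⟩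

theorem exists_double_coset_cover_of_surjective {G H : Type*} [Group G] [Group H]
    [TopologicalSpace H] [IsTopologicalGroup H] (hH : IsRoelckePrecompact H) (φ : G →* H)
    (hφ : Function.Surjective φ) {U : Set G} (hU : U ∈ comap φ (𝓝 1)) :
    ∃ F : Set G, F.Finite ∧ ∀ g, ∃ u ∈ U, ∃ f ∈ F, ∃ v ∈ U, g = u * f * v := by
  rw [isRoelckePrecompact_iff] at hH
  obtain ⟨V, hV, hVU⟩ := hU
  obtain ⟨F, hF, h⟩ := hH V hV
  choose s hs using hφ
  refine ⟨s '' F, hF.image s, fun g => ?_⟩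
  obtain ⟨u, hu, f, hf, v, hv, e⟩ := h (φ g)
  -- The last factor absorbs the kernel error of the section `s`; it lies in `U` because `U`
  -- contains the whole preimage of `V`.
  refine ⟨s u, hVU (by simpa [hs] using hu), s f, mem_image_of_mem s hf,
    (s u * s f)⁻¹ * g, hVU ?_, by group⟩
  have : φ ((s u * s f)⁻¹ * g) = v := by
    simp only [map_mul, map_inv, hs, e]; group
  rw [mem_preimage, this]; exact hv

/-! ### The relations `∼_J` -/

section Relation

variable {X : Type*} [LinearOrder X]

theorem intervalRel.trans {J : Set X} {x y z : X} (h₁ : intervalRel J x y)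
    (h₂ : intervalRel J y z) : intervalRel J x z :=
  fun g hg => h₂ g (h₁ g hg)

theorem intervalRel.apply {J : Set X} {x y : X} (h : intervalRel J x y) (g : X ≃o X) :
    intervalRel J (g x) (g y) :=
  fun k hk => h (g.trans k) hk

theorem intervalRel_apply_iff {J : Set X} {x y : X} (g : X ≃o X) :
    intervalRel J (g x) (g y) ↔ intervalRel J x y :=
  ⟨fun h => by simpa using h.apply g.symm, fun h => h.apply g⟩

theorem IsRegularInterval.intervalRel_of_mem {J : Set X} (hJ : IsRegularInterval J) {x y : X}
    (hx : x ∈ J) (hy : y ∈ J) : intervalRel J x y :=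
  fun g hg => hJ.regular x hx y hy g hg

theorem intervalRel_left_of_between (hX : IsHomogeneousChain X) {J : Set X}
    (hJ : IsRegularInterval J) {x y z : X} (h : intervalRel J x y) (hxz : x ≤ z) (hzy : z ≤ y) :
    intervalRel J x z :=
  (IntervalQuotient.mk_eq_mk hX hJ).1
    (IntervalQuotient.mk_eq_of_between hX hJ ((IntervalQuotient.mk_eq_mk hX hJ).2 h) hxz hzy)

theorem intervalRel_right_of_between (hX : IsHomogeneousChain X) {J : Set X}
    (hJ : IsRegularInterval J) {x y z : X} (h : intervalRel J x y) (hxz : x ≤ z) (hzy : z ≤ y) :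
    intervalRel J z y :=
  (intervalRel_symm hX hJ (intervalRel_left_of_between hX hJ h hxz hzy)).trans h

theorem exists_not_intervalRel (hX : IsHomogeneousChain X) {J : Set X}
    (hJ : IsProperRegularInterval J) (x : X) : ∃ y, ¬ intervalRel J x y := by
  obtain ⟨z, hz⟩ := (ne_univ_iff_exists_notMem J).1 hJ.ne_univ
  obtain ⟨a, ha⟩ := hJ.nonempty
  obtain ⟨g, hg⟩ := hX x a
  refine ⟨g.symm z, fun h => hz ?_⟩
  simpa using h g (hg ▸ ha)

theorem exists_lt_intervalRel_lt (hX : IsHomogeneousChain X) {J : Set X}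
    (hJ : IsProperRegularInterval J) (x : X) :
    (∃ a < x, intervalRel J x a) ∧ ∃ b > x, intervalRel J x b := by
  obtain ⟨p, hp, q, hq, hpq⟩ := hJ.nontrivial.exists_lt
  constructor
  · obtain ⟨g, rfl⟩ := hX q x
    exact ⟨g p, g.strictMono hpq, (hJ.intervalRel_of_mem hq hp).apply g⟩
  · obtain ⟨g, rfl⟩ := hX p x
    exact ⟨g q, g.strictMono hpq, (hJ.intervalRel_of_mem hp hq).apply g⟩

/-- The relations of two regular intervals are comparable. -/
theorem intervalRel_le_total (hX : IsHomogeneousChain X) {J K : Set X}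
    (hJ : IsRegularInterval J) (hK : IsRegularInterval K) :
    (∀ x y, intervalRel J x y → intervalRel K x y) ∨
      ∀ x y, intervalRel K x y → intervalRel J x y := by
  have exists_lt : ∀ {A B : Set X}, IsRegularInterval A → IsRegularInterval B →
      (∃ x y, intervalRel A x y ∧ ¬ intervalRel B x y) →
      ∃ x y, x < y ∧ intervalRel A x y ∧ ¬ intervalRel B x y := by
    rintro A B hA hB ⟨x, y, h, h'⟩
    rcases lt_trichotomy x y with hxy | rfl | hxy
    · exact ⟨x, y, hxy, h, h'⟩
    · exact absurd (fun _ hg => hg) h'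
    · exact ⟨y, x, hxy, intervalRel_symm hX hA h, fun k => h' (intervalRel_symm hX hB k)⟩
  by_contra! hcon
  obtain ⟨h₁, h₂⟩ := hcon
  obtain ⟨a, x, hax, hJax, hKax⟩ := exists_lt hJ hK h₁
  obtain ⟨r, s, hrs, hKrs, hJrs⟩ := exists_lt hK hJ h₂
  -- Move `r` to `x` by `k` and `a` to `x` by `g`. Convexity puts `g x` before `k s`, which leaves
  -- the `J`-class of `x`. So `g x` is `K`-related to `x = g a`, and pulling back by `g` relates `a`
  -- and `x`.
  obtain ⟨k, rfl⟩ := hX r x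
  obtain ⟨g, hg⟩ := hX a (k r)
  have hJx : intervalRel J (k r) (g (k r)) := by simpa [hg] using hJax.apply g
  have hxg : k r < g (k r) := by simpa [hg] using g.strictMono hax
  have hgs : g (k r) ≤ k s := by
    by_contra! hlt
    exact hJrs ((intervalRel_apply_iff k).1
      (intervalRel_left_of_between hX hJ hJx (k.strictMono hrs).le hlt.le))
  have hKx := intervalRel_left_of_between hX hK (hKrs.apply k) hxg.le hgs
  rw [← hg, intervalRel_apply_iff, hg] at hKx
  exact hKax hKx

/-! ### Separation of points by proper regular intervals -/

theorem exists_isProperRegularInterval (hX : IsHomogeneousChain X) (hns : ¬ IsSimpleChain X) :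
    ∃ J : Set X, IsProperRegularInterval J := by
  by_contra! h
  exact hns ⟨hX, h⟩

/-- The automorphism of a set `K` induced by an automorphism of the chain that preserves `K`. -/
def restrictOrderIso (g : X ≃o X) {K : Set X} (hg : ∀ z, z ∈ K ↔ g z ∈ K) : K ≃o K where
  toEquiv := g.toEquiv.subtypeEquiv hg
  map_rel_iff' := by
    rintro ⟨a, _⟩ ⟨b, _⟩
    exact g.le_iff_le

theorem IsRegularInterval.mem_iff_apply_mem {K : Set X} (hK : IsRegularInterval K) {x : X}
    (hx : x ∈ K) {g : X ≃o X} (hgx : g x ∈ K) (z : X) : z ∈ K ↔ g z ∈ K :=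
  ⟨fun hz => hK.regular x hx z hz g hgx, fun hz => by
    simpa using hK.regular (g x) hgx (g z) hz g.symm (by simpa using hx)⟩

theorem IsRegularInterval.isHomogeneousChain (hX : IsHomogeneousChain X) {K : Set X}
    (hK : IsRegularInterval K) : IsHomogeneousChain K := by
  rintro ⟨x, hx⟩ ⟨y, hy⟩
  obtain ⟨g, rfl⟩ := hX x y
  exact ⟨restrictOrderIso g (hK.mem_iff_apply_mem hx hy), rfl⟩

/-- A regular interval of a regular interval `K` of `X` is a regular interval of `X`. -/
theorem IsRegularInterval.image_val {K : Set X} (hK : IsRegularInterval K) {L : Set K}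
    (hL : IsRegularInterval L) : IsRegularInterval (Subtype.val '' L) where
  nonempty := hL.nonempty.image _
  ordConnected := by
    refine ⟨?_⟩
    rintro _ ⟨x, hx, rfl⟩ _ ⟨y, hy, rfl⟩ z ⟨hxz, hzy⟩
    have hz : z ∈ K := hK.ordConnected.out x.2 y.2 ⟨hxz, hzy⟩
    exact ⟨⟨z, hz⟩, hL.ordConnected.out hx hy ⟨hxz, hzy⟩, rfl⟩
  regular := by
    rintro _ ⟨x, hx, rfl⟩ _ ⟨y, hy, rfl⟩ g ⟨w, hw, hwx⟩
    have hgx : g x ∈ K := hwx ▸ w.2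
    let k := restrictOrderIso g (hK.mem_iff_apply_mem x.2 hgx)
    have hkx : k x = w := Subtype.ext hwx.symm
    exact ⟨k y, hL.regular x hx y hy k (hkx ▸ hw), rfl⟩

/-- If no proper regular interval is simple, the relations of the proper regular intervals
separate points. -/
theorem exists_not_intervalRel_of_ne (hX : IsHomogeneousChain X) (hns : ¬ IsSimpleChain X)
    (hno : ∀ J : Set X, IsProperRegularInterval J → ¬ IsSimpleChain J) {x y : X} (hxy : x ≠ y) :
    ∃ J : Set X, IsProperRegularInterval J ∧ ¬ intervalRel J x y := by
  by_contra! hcon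
  let K : Set X := {z | ∀ J : Set X, IsProperRegularInterval J → intervalRel J x z}
  have hxK : x ∈ K := fun _ _ _ hg => hg
  have hK : IsProperRegularInterval K := by
    refine ⟨⟨⟨x, hxK⟩, ⟨?_⟩, ?_⟩, ⟨x, hxK, y, hcon, hxy⟩, ?_⟩
    · intro u hu v hv z hz J hJ
      have hu := hu J hJ
      have huv := (intervalRel_symm hX hJ.1 hu).trans (hv J hJ)
      exact hu.trans (intervalRel_left_of_between hX hJ.1 huv hz.1 hz.2)
    · intro u hu v hv g hg J hJ
      exact (hg J hJ).trans (((intervalRel_symm hX hJ.1 (hu J hJ)).trans (hv J hJ)).apply g)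
    · intro huniv
      -- Non-simplicity makes the intersection defining `K` nonempty-indexed; otherwise `K` would be
      -- everything.
      obtain ⟨J, hJ⟩ := exists_isProperRegularInterval hX hns
      obtain ⟨z, hz⟩ := exists_not_intervalRel hX hJ x
      have hzK : z ∈ K := huniv ▸ mem_univ z
      exact hz (hzK J hJ)
  refine hno K hK ⟨hK.isHomogeneousChain hX, fun L hL => ?_⟩
  -- The image of `L` in `X` is one of the intervals intersected over, so its relation identifies
  -- all points of `K`, in particular `p ∈ L` and `k ∉ L`.
  obtain ⟨k, hk⟩ := (ne_univ_iff_exists_notMem L).1 hL.ne_univ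
  obtain ⟨p, hp⟩ := hL.nonempty
  have hkM : (k : X) ∉ Subtype.val '' L := by
    rintro ⟨w, hw, hwk⟩
    exact hk (Subtype.ext hwk ▸ hw)
  have hM : IsProperRegularInterval (Subtype.val '' L) :=
    ⟨hK.image_val hL.1, hL.nontrivial.image Subtype.val_injective,
      (ne_univ_iff_exists_notMem _).2 ⟨k, hkM⟩⟩
  have hpk := (intervalRel_symm hX hM.1 (p.2 _ hM)).trans (k.2 _ hM)
  exact hkM (hpk (OrderIso.refl X) (mem_image_of_mem _ hp))

end Relation

/-! ### The action on the quotient chain -/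

namespace IntervalQuotient

variable {X : Type*} [LinearOrder X] (hX : IsHomogeneousChain X) {J : Set X}
  (hJ : IsRegularInterval J)

/-- The map induced on `X/J` by an automorphism of `X`. -/
def map (g : X ≃o X) : IntervalQuotient hX hJ → IntervalQuotient hX hJ :=
  Quotient.map g fun _ _ h => intervalRel.apply h g

@[simp]
theorem map_mk (g : X ≃o X) (x : X) : map hX hJ g (mk hX hJ x) = mk hX hJ (g x) := rfl

/-- The automorphism of `X/J` induced by an automorphism of `X`. -/
def mapOrderIso (g : X ≃o X) : IntervalQuotient hX hJ ≃o IntervalQuotient hX hJ where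
  toFun := map hX hJ g
  invFun := map hX hJ g.symm
  left_inv P := by
    obtain ⟨x, rfl⟩ := exists_mk hX hJ P
    simp
  right_inv P := by
    obtain ⟨x, rfl⟩ := exists_mk hX hJ P
    simp
  map_rel_iff' {P Q} := by
    obtain ⟨x, rfl⟩ := exists_mk hX hJ P
    obtain ⟨y, rfl⟩ := exists_mk hX hJ Q
    change mk hX hJ (g x) ≤ mk hX hJ (g y) ↔ mk hX hJ x ≤ mk hX hJ y
    rw [mk_le_mk, mk_le_mk, mk_eq_mk, mk_eq_mk, intervalRel_apply_iff,
      g.le_iff_le]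

/-- The homomorphism `Aut X → Aut (X/J)`. -/
def autHom : AutPointwise X →* AutPermutation (IntervalQuotient hX hJ) where
  toFun g := mapOrderIso hX hJ g
  map_one' := by
    refine OrderIso.ext (funext fun P => ?_)
    obtain ⟨x, rfl⟩ := exists_mk hX hJ P
    rfl
  map_mul' f g := by
    refine OrderIso.ext (funext fun P => ?_)
    obtain ⟨x, rfl⟩ := exists_mk hX hJ P
    rfl

theorem eval_autHom_mk (g : AutPointwise X) (x : X) :
    (autHom hX hJ g).eval (mk hX hJ x) = mk hX hJ (g.eval x) := rfl

theorem mk_apply_eq_mk_apply_iff (g : X ≃o X) {x y : X} :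
    mk hX hJ (g x) = mk hX hJ (g y) ↔ mk hX hJ x = mk hX hJ y := by
  rw [mk_eq_mk, mk_eq_mk, intervalRel_apply_iff]

theorem lt_of_mk_lt_mk {x y : X} (h : mk hX hJ x < mk hX hJ y) : x < y := by
  by_contra! hle
  exact absurd ((mk_le_mk hX hJ).2 (Or.inl hle)) (not_le.2 h)

theorem mk_le_mk_of_le {x y : X} (h : x ≤ y) : mk hX hJ x ≤ mk hX hJ y :=
  (mk_le_mk hX hJ).2 (Or.inl h)

/-- Each automorphism of `X/J` lifts to an automorphism of `X`. -/
theorem exists_lift (φ : IntervalQuotient hX hJ ≃o IntervalQuotient hX hJ) :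
    ∃ f : X ≃o X, ∀ x, mk hX hJ (f x) = φ (mk hX hJ x) := by
  -- By homogeneity some automorphism `g P` carries the class `P` onto `φ P`; the lift uses `g P` on
  -- each class `P`.
  have hex : ∀ P : IntervalQuotient hX hJ, ∃ g : X ≃o X, ∀ x,
      mk hX hJ (g x) = φ P ↔ mk hX hJ x = P := by
    intro P
    obtain ⟨p, rfl⟩ := exists_mk hX hJ P
    obtain ⟨q, hq⟩ := exists_mk hX hJ (φ (mk hX hJ p))
    obtain ⟨g, rfl⟩ := hX p q
    exact ⟨g, fun x => by rw [← hq, mk_apply_eq_mk_apply_iff]⟩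
  choose g hg using hex
  have hmk : ∀ x, mk hX hJ (g (mk hX hJ x) x) = φ (mk hX hJ x) := fun x => (hg _ x).2 rfl
  have hmono : StrictMono fun x => g (mk hX hJ x) x := by
    intro x y hxy
    rcases (mk_le_mk_of_le hX hJ hxy.le).eq_or_lt with h | h
    · change g (mk hX hJ x) x < g (mk hX hJ y) y
      rw [h]
      exact (g _).strictMono hxy
    · refine lt_of_mk_lt_mk hX hJ ?_
      rw [hmk, hmk]
      exact φ.strictMono h
  have hsurj : Function.Surjective fun x => g (mk hX hJ x) x := by
    intro y
    have hP : mk hX hJ ((g (φ.symm (mk hX hJ y))).symm y) = φ.symm (mk hX hJ y) :=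
      (hg _ _).1 (by simp)
    refine ⟨(g (φ.symm (mk hX hJ y))).symm y, ?_⟩
    change g (mk hX hJ ((g (φ.symm (mk hX hJ y))).symm y)) _ = y
    rw [hP, OrderIso.apply_symm_apply]
  exact ⟨hmono.orderIsoOfSurjective _ hsurj, hmk⟩

theorem autHom_surjective : Function.Surjective (autHom hX hJ) := by
  intro φ
  obtain ⟨f, hf⟩ := exists_lift hX hJ φ
  refine ⟨f, OrderIso.ext (funext fun P => ?_)⟩
  obtain ⟨x, rfl⟩ := exists_mk hX hJ P
  exact hf x

/-- Points `a < x < b` of the class of `x` bound an open interval inside it, and `g x` in that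
interval forces `g` to fix the class. -/
theorem tendsto_autHom_one (hJ : IsProperRegularInterval J) :
    Tendsto (autHom hX hJ.toIsRegularInterval) (𝓝 1) (𝓝 1) := by
  rw [AutPermutation.tendsto_iff]
  intro P
  obtain ⟨x, rfl⟩ := exists_mk hX hJ.1 P
  obtain ⟨⟨a, hax, ha⟩, b, hxb, hb⟩ := exists_lt_intervalRel_lt hX hJ x
  have h := AutPointwise.tendsto_iff.1 (tendsto_id (x := 𝓝 (1 : AutPointwise X))) x
  filter_upwards [h.1 a hax, h.2 b hxb] with g hga hgb
  rw [eval_autHom_mk]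
  change mk hX hJ.1 (g.eval x) = mk hX hJ.1 x
  rw [eq_comm, mk_eq_mk]
  have hab := (intervalRel_symm hX hJ.1 ha).trans hb
  exact ha.trans (intervalRel_left_of_between hX hJ.1 hab hga.le hgb.le)

/-- An automorphism that fixes the `J`-class of `x` also fixes the coarser `K`-class. -/
theorem comap_autHom_mono {K : Set X} (hK : IsRegularInterval K)
    (h : ∀ x y, intervalRel J x y → intervalRel K x y) :
    comap (autHom hX hJ) (𝓝 1) ≤ comap (autHom hX hK) (𝓝 1) := by
  rw [← tendsto_iff_comap, AutPermutation.tendsto_iff]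
  intro P
  obtain ⟨x, rfl⟩ := exists_mk hX hK P
  have ht := AutPermutation.tendsto_iff.1
    (tendsto_comap (f := autHom hX hJ) (x := 𝓝 1)) (mk hX hJ x)
  filter_upwards [ht] with g hg
  exact (mk_eq_mk hX hK).2 (h _ _ ((mk_eq_mk hX hJ).1 hg))

end IntervalQuotient

/-! ### Comparison of `τ_p` with the quotient topologies -/

open IntervalQuotient in
/-- If no proper regular interval is simple, the neighbourhoods of the unit for `τ_p` come from
the quotients by proper regular intervals. -/
theorem exists_mem_comap_autHom {X : Type*} [LinearOrder X] (hX : IsHomogeneousChain X)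
    (hns : ¬ IsSimpleChain X)
    (hno : ∀ J : Set X, IsProperRegularInterval J → ¬ IsSimpleChain J)
    {U : Set (AutPointwise X)} (hU : U ∈ 𝓝 1) :
    ∃ (J : Set X) (hJ : IsProperRegularInterval J),
      U ∈ comap (autHom hX hJ.toIsRegularInterval) (𝓝 1) := by
  let l : {J : Set X // IsProperRegularInterval J} → Filter (AutPointwise X) :=
    fun J => comap (autHom hX J.2.toIsRegularInterval) (𝓝 1)
  have hne : Nonempty {J : Set X // IsProperRegularInterval J} :=
    nonempty_subtype.2 (exists_isProperRegularInterval hX hns)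
  -- Directedness ensures that a set in the infimum already lies in a single `l J`.
  have hdir : Directed (· ≥ ·) l := by
    intro J K
    rcases intervalRel_le_total hX J.2.1 K.2.1 with h | h
    · exact ⟨J, le_rfl, comap_autHom_mono hX J.2.1 K.2.1 h⟩
    · exact ⟨K, comap_autHom_mono hX K.2.1 J.2.1 h, le_rfl⟩
  have hev : ∀ (J : {J : Set X // IsProperRegularInterval J}) (x : X),
      ∀ᶠ g in ⨅ J, l J, intervalRel J.1 (g.eval x) x := by
    intro J x
    have ht := AutPermutation.tendsto_iff.1
      ((tendsto_comap (f := autHom hX J.2.1) (x := 𝓝 1)).mono_left (iInf_le l J)) (mk hX J.2.1 x)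
    filter_upwards [ht] with g hg
    exact (mk_eq_mk hX J.2.1).1 hg
  have hle : Tendsto id (⨅ J, l J) (𝓝 (1 : AutPointwise X)) := by
    rw [AutPointwise.tendsto_iff]
    refine fun x => ⟨fun a ha => ?_, fun a ha => ?_⟩
    · change a < x at ha
      -- Once `J` separates `a` from `x`, convexity keeps the whole class of `x`, hence `g x`, on
      -- one side of `a`.
      obtain ⟨J, hJ, hJa⟩ := exists_not_intervalRel_of_ne hX hns hno ha.ne
      filter_upwards [hev ⟨J, hJ⟩ x] with g hg
      by_contra! hlt
      exact hJa (intervalRel_right_of_between hX hJ.1 hg hlt ha.le)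
    · change x < a at ha
      obtain ⟨J, hJ, hJa⟩ := exists_not_intervalRel_of_ne hX hns hno ha.ne
      filter_upwards [hev ⟨J, hJ⟩ x] with g hg
      by_contra! hlt
      exact hJa (intervalRel_left_of_between hX hJ.1 (intervalRel_symm hX hJ.1 hg) ha.le hlt)
  obtain ⟨J, hJ⟩ := (mem_iInf_of_directed hdir U).1 (hle hU)
  exact ⟨J.1, J.2, hJ⟩

theorem mainTheorem11 {X : Type*} [LinearOrder X] (hX : IsHomogeneousChain X)
    (hns : ¬ IsSimpleChain X)
    (hno : ∀ J : Set X, IsProperRegularInterval J → ¬ IsSimpleChain J) :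
    IsRoelckePrecompact (AutPointwise X) ↔
      ∀ (J : Set X) (hJ : IsProperRegularInterval J),
        IsRoelckePrecompact (AutPermutation (IntervalQuotient hX hJ.toIsRegularInterval)) := by
  constructor
  · intro h J hJ
    exact h.of_surjective (IntervalQuotient.autHom hX hJ.toIsRegularInterval)
      (IntervalQuotient.autHom_surjective hX hJ.toIsRegularInterval)
      (IntervalQuotient.tendsto_autHom_one hX hJ)
  · intro h
    rw [isRoelckePrecompact_iff]
    intro U hU
    obtain ⟨J, hJ, hUJ⟩ := exists_mem_comap_autHom hX hns hno hU
    exact exists_double_coset_cover_of_surjective (h J hJ) _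
      (IntervalQuotient.autHom_surjective hX hJ.toIsRegularInterval) hUJ
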